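/- Let $(X_t)_{t\in\mathbb N_0}$ be a strictly stationary time series of $\mathbb R^d$-valued random vectors, let $x_*>0$, let $(k_n)$ be a sequence of positive integers and $(a_m)$ a sequence of normalizing constants with $a_{k_n}>0$ for all large $n$ (write $a_k=a_{k_n}$; for instance, $a_m$ is the $(1-1/m)$-quantile of $\|X_0\|$ for a regularly varying series and $k_n\to\infty$), and put $$v_n:=P\{X_0\notin(-\infty,a_kx_*)^d\},\qquad \tilde X_{n,i}:=\frac{X_i}{a_k}1_{\mathbb R^d\setminus(-\infty,x_*)^d}\Big(\frac{X_i}{a_k}\Big).$$ Assume that * (B1) the rows $(\tilde X_{n,i})_{1\le i\le n}$ are stationary and, for natural numbers $\ell_n,r_n$, $\ell_n=o(r_n)$, $\ell_n\to\infty$, $r_n=o(n)$, $r_nv_n\to0$, $nv_n\to\infty$; * for some $\delta>0$, $\;E\Big(\sum_{i=1}^{r_n}1_{\{X_i\notin(-\infty,a_kx_*)^d\}}\Big)^{2+\delta}=O(r_nv_n)$ as $n\to\infty$. For lags $h,\tilde h\in\mathbb N_0$ let $X_{n,i}^{(h,\tilde h)}:=(\tilde X_{n,i},\tilde X_{n,i+h},\tilde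 X_{n,i+\tilde h})\in\mathbb R^{3d}$, $v_n^{(h,\tilde h)}:=P\{X_{n,1}^{(h,\tilde h)}\neq0\}$, $m_n:=\lfloor n/r_n\rfloor$, and let $Y_{n,1}^*,\dots,Y_{n,m_n}^*$ be i.i.d. copies of the block $(X_{n,i}^{(h,\tilde h)})_{1\le i\le r_n}$. For a family $\mathcal C$ of pairs $(A,B)$ of subsets of $\mathbb R^d$ let $$\mathcal F_{\mathcal C}:=\{f_D\mid D=A\times B\times\mathbb R^d\text{ or }D=A\times\mathbb R^d\times B,\ (A,B)\in\mathcal C\},\qquad f_D(y_1,\dots,y_r):=\sum_{i=1}^r1_D(y_i),$$ let $d_n(f,g):=\big(\frac1{nv_n^{(h,\tilde h)}}\sum_{j=1}^{m_n}(f(Y_{n,j}^*)-g(Y_{n,j}^*))^2\big)^{1/2}$, and let $N(\varepsilon,\mathcal F_{\mathcal C},d_n)$ be the minimal number of $d_n$-balls of radius $\varepsilon$, with centres in $\mathcal F_{\mathcal C}$, needed to cover $\mathcal F_{\mathcal C}$. With $P^*$ denoting outer probability, the entropy condition (D6) for $\mathcal C$ reads $$\lim_{\eta\downarrow0}\limsup_{n\to\infty}P^*\Big\{\int_0^\eta\sqrt{\log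 N(\varepsilon,\mathcal F_{\mathcal C},d_n)}\,d\varepsilon>\tau\Big\}=0\qquad\text{for all }\tau>0.$$ Then, for all lags $h,\tilde h\in\mathbb N_0$, condition (D6) holds for the family built from upper right orthants $(x,\infty)=\prod_{j=1}^d(x_j,\infty)$, $$\mathcal C=\big\{\big((x_A,\infty),(x_B,\infty)\big)\mid x_A,x_B\notin(-\infty,x_*]^d\big\}\cup\big\{\big((x_A,\infty),\mathbb R^d\big)\mid x_A\notin(-\infty,x_*]^d\big\},$$ and likewise for the family built from complements of lower left orthants $(-\infty,x]=\prod_{j=1}^d(-\infty,x_j]$, $$\mathcal C=\big\{\big(\mathbb R^d\setminus(-\infty,x_A],\mathbb R^d\setminus(-\infty,x_B]\big),\ \big(\mathbb R^d\setminus(-\infty,x_A],\mathbb R^d\big)\mid x_A,x_B\in(x_*,\infty)^d\big\}.$$ -/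

import Mathlib

open MeasureTheory ProbabilityTheory Filter Topology Asymptotics
open scoped ENNReal

noncomputable section

namespace Extremogram

/-! ### Triangular arrays and blocks -/

/-- The set of vectors of arbitrary length with components in `E`. -/
abbrev Cluster (E : Type*) : Type _ := Σ l : ℕ, Fin l → E

/-- Strict stationarity of a time series indexed by the nonnegative integers. -/
def IsStationary {Ω S : Type*} [MeasurableSpace Ω] [MeasurableSpace S]
    (P : Measure Ω) (X : ℕ → Ω → S) : Prop :=
  ∀ s : ℕ, IdentDistrib (fun ω t => X (t + s) ω) (fun ω t => X t ω) P P

/-- Row-wise stationarity of a triangular array `(X n i)`, `1 ≤ i ≤ n`. -/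
def IsRowStationary {Ω E : Type*} [MeasurableSpace Ω] [MeasurableSpace E]
    (P : Measure Ω) (X : ℕ → ℕ → Ω → E) : Prop :=
  ∀ n s L : ℕ, s + L ≤ n →
    IdentDistrib (fun ω (i : Fin L) => X n (s + (i : ℕ) + 1) ω)
      (fun ω (i : Fin L) => X n ((i : ℕ) + 1) ω) P P

/-- The probability `P{X_{n,1} ≠ 0}` that an entry of the `n`-th row is nonzero. -/
def nonzeroProb {Ω E : Type*} [MeasurableSpace Ω] [Zero E]
    (P : Measure Ω) (X : ℕ → ℕ → Ω → E) (n : ℕ) : ℝ :=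
  P.real {ω | X n 1 ω ≠ 0}

/-- Condition (B1), with `v_n = P{X_{n,1} ≠ 0}`: the rows are stationary, `ℓ_n = o(r_n)`,
`ℓ_n → ∞`, `r_n = o(n)`, `r_n v_n → 0` and `n v_n → ∞`. -/
structure CondB1 {Ω E : Type*} [MeasurableSpace Ω] [MeasurableSpace E] [Zero E]
    (P : Measure Ω) (X : ℕ → ℕ → Ω → E) (l r : ℕ → ℕ) : Prop where
  row_stationary : IsRowStationary P X
  l_isLittleO : (fun n => (l n : ℝ)) =o[atTop] (fun n => (r n : ℝ))
  l_tendsto : Tendsto l atTop atTop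
  r_isLittleO : (fun n : ℕ => (r n : ℝ)) =o[atTop] (fun n : ℕ => (n : ℝ))
  r_mul_v : Tendsto (fun n : ℕ => (r n : ℝ) * nonzeroProb P X n) atTop (𝓝 0)
  n_mul_v : Tendsto (fun n : ℕ => (n : ℝ) * nonzeroProb P X n) atTop atTop

/-- The first block `Y_{n,1} = (X_{n,1}, …, X_{n,r_n})` of the `n`-th row. -/
def firstBlock {Ω E : Type*} (X : ℕ → ℕ → Ω → E) (r : ℕ → ℕ) (n : ℕ) (ω : Ω) :
    Fin (r n) → E :=
  fun i => X n ((i : ℕ) + 1) ω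

/-- For each `n`, the family `(Y*_{n,j})`, `1 ≤ j ≤ m_n = ⌊n / r_n⌋`, consists of i.i.d. copies of
the first block `Y_{n,1}`; the copies may live on a probability space of their own. -/
structure IsIIDCopies {Ω Ω' E : Type*} [MeasurableSpace Ω] [MeasurableSpace Ω']
    [MeasurableSpace E] (P : Measure Ω) (P' : Measure Ω') (X : ℕ → ℕ → Ω → E) (r : ℕ → ℕ)
    (Ystar : ∀ n : ℕ, Fin (n / r n) → Ω' → (Fin (r n) → E)) : Prop where
  indep : ∀ n, iIndepFun (Ystar n) P'
  identDistrib : ∀ n j, IdentDistrib (Ystar n j) (firstBlock X r n) P' P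

/-! ### Metric entropy -/

/-- The covering number `N(ε, S, ρ)`: the minimal number of balls `{f ∈ S | ρ(f, g) < ε}` with
centres `g` in `S` that are needed to cover `S` (it is `⊤` if no finite number suffices). -/
def coveringNumber {α : Type*} (ρ : α → α → ℝ) (S : Set α) (ε : ℝ) : ℕ∞ :=
  ⨅ (T : Finset α) (_ : (T : Set α) ⊆ S) (_ : ∀ f ∈ S, ∃ g ∈ T, ρ f g < ε), (T.card : ℕ∞)

/-- The entropy integral `∫_0^δ (log N(ε, S, ρ))^{1/2} dε`, with values in `[0, ∞]`. -/
def entropyIntegral {α : Type*} (ρ : α → α → ℝ) (S : Set α) (δ : ℝ) : ℝ≥0∞ :=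
  ∫⁻ ε in Set.Ioc 0 δ,
    (ENNReal.log ((coveringNumber ρ S ε : ℕ∞) : ℝ≥0∞)).toENNReal ^ (1 / 2 : ℝ)

/-- The semi-metric
`d_n(f, g) = ((n v)⁻¹ ∑_{j ≤ m} (f(Y_j) - g(Y_j))²)^{1/2}` for blocks `Y_1, …, Y_m`. -/
def blockDist {E : Type*} {m q : ℕ} (n : ℕ) (v : ℝ) (Y : Fin m → (Fin q → E))
    (f g : Cluster E → ℝ) : ℝ :=
  Real.sqrt ((1 / ((n : ℝ) * v)) * ∑ j, (f ⟨q, Y j⟩ - g ⟨q, Y j⟩) ^ 2)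

/-- Condition (D6) for the family `F` of functionals: for all `τ > 0`,
`lim_{δ ↓ 0} limsup_n P*{∫_0^δ (log N(ε, F, d_n))^{1/2} dε > τ} = 0`.
A measure applied to an arbitrary set is the outer measure of the set. -/
def CondD6 {Ω' E : Type*} [MeasurableSpace Ω'] (P' : Measure Ω') (F : Set (Cluster E → ℝ))
    (v : ℕ → ℝ) (r : ℕ → ℕ) (Ystar : ∀ n : ℕ, Fin (n / r n) → Ω' → (Fin (r n) → E)) : Prop :=
  ∀ τ : ℝ, 0 < τ →
    Tendsto
      (fun δ : ℝ => limsup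
        (fun n : ℕ => P' {ω | ENNReal.ofReal τ <
          entropyIntegral (blockDist n (v n) (fun j => Ystar n j ω)) F δ}) atTop)
      (𝓝[>] 0) (𝓝 0)

/-! ### The extremogram setting -/

/-- The open lower left orthant `(-∞, c)^d`. -/
def lowerBox (d : ℕ) (c : ℝ) : Set (Fin d → ℝ) := {x | ∀ j, x j < c}

/-- The upper right orthant `(x, ∞)`. -/
def upperOrthant {d : ℕ} (x : Fin d → ℝ) : Set (Fin d → ℝ) := {y | ∀ j, x j < y j}

open Classical in
/-- The standardized extremes `(X_i / b_n) 1{X_i / b_n ∉ (-∞, x_*)^d}`. -/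
def tildeX {Ω : Type*} {d : ℕ} (X : ℕ → Ω → (Fin d → ℝ)) (b : ℕ → ℝ) (xs : ℝ)
    (n i : ℕ) (ω : Ω) : Fin d → ℝ :=
  if (b n)⁻¹ • X i ω ∈ lowerBox d xs then 0 else (b n)⁻¹ • X i ω

/-- The array `X_{n,i}^{(h, h')} = (X̃_{n,i}, X̃_{n,i+h}, X̃_{n,i+h'})`. -/
def lagX {Ω : Type*} {d : ℕ} (X : ℕ → Ω → (Fin d → ℝ)) (b : ℕ → ℝ) (xs : ℝ) (h h' : ℕ)
    (n i : ℕ) (ω : Ω) : (Fin d → ℝ) × (Fin d → ℝ) × (Fin d → ℝ) :=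
  (tildeX X b xs n i ω, tildeX X b xs n (i + h) ω, tildeX X b xs n (i + h') ω)

/-- `v_n = P{X_0 ∉ (-∞, b_n x_*)^d}`. -/
def exceedProb {Ω : Type*} [MeasurableSpace Ω] {d : ℕ} (P : Measure Ω)
    (X : ℕ → Ω → (Fin d → ℝ)) (b : ℕ → ℝ) (xs : ℝ) (n : ℕ) : ℝ :=
  P.real {ω | X 0 ω ∉ lowerBox d (b n * xs)}

open Classical in
/-- `E (∑_{i=1}^{r_n} 1{X_i ∉ (-∞, b_n x_*)^d})^p`. -/
def exceedMoment {Ω : Type*} [MeasurableSpace Ω] {d : ℕ} (P : Measure Ω)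
    (X : ℕ → Ω → (Fin d → ℝ)) (b : ℕ → ℝ) (xs : ℝ) (r : ℕ → ℕ) (p : ℝ) (n : ℕ) : ℝ :=
  ∫ ω, (∑ i ∈ Finset.Icc 1 (r n),
    if X i ω ∈ lowerBox d (b n * xs) then (0 : ℝ) else 1) ^ p ∂P

/-- The generalized tail array sum `f_D(y_1, …, y_l) = ∑_{i ≤ l} 1_D(y_i)`. -/
def countFunctional {E : Type*} (D : Set E) (y : Cluster E) : ℝ :=
  ∑ i, D.indicator (fun _ => (1 : ℝ)) (y.2 i)

/-- The family `{f_D | D = A × B × ℝ^d or D = A × ℝ^d × B, (A, B) ∈ C}`. -/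
def functionalFamily {d : ℕ} (C : Set (Set (Fin d → ℝ) × Set (Fin d → ℝ))) :
    Set (Cluster ((Fin d → ℝ) × (Fin d → ℝ) × (Fin d → ℝ)) → ℝ) :=
  {f | ∃ p ∈ C, f = countFunctional (p.1 ×ˢ p.2 ×ˢ Set.univ) ∨
    f = countFunctional (p.1 ×ˢ Set.univ ×ˢ p.2)}

/-- The pairs `((x_A, ∞), (x_B, ∞))` and `((x_A, ∞), ℝ^d)` with `x_A, x_B ∉ (-∞, x_*]^d`. -/
def upperFamily (d : ℕ) (xs : ℝ) : Set (Set (Fin d → ℝ) × Set (Fin d → ℝ)) :=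
  {p | ∃ xA xB : Fin d → ℝ, (¬ ∀ j, xA j ≤ xs) ∧ (¬ ∀ j, xB j ≤ xs) ∧
      p = (upperOrthant xA, upperOrthant xB)} ∪
  {p | ∃ xA : Fin d → ℝ, (¬ ∀ j, xA j ≤ xs) ∧ p = (upperOrthant xA, Set.univ)}

/-- The pairs `(ℝ^d \ (-∞, x_A], ℝ^d \ (-∞, x_B])` and `(ℝ^d \ (-∞, x_A], ℝ^d)` with
`x_A, x_B ∈ (x_*, ∞)^d`. The set `(-∞, x]` is the order interval of the componentwise order. -/
def lowerComplFamily (d : ℕ) (xs : ℝ) : Set (Set (Fin d → ℝ) × Set (Fin d → ℝ)) :=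
  {p | ∃ xA xB : Fin d → ℝ, (∀ j, xs < xA j) ∧ (∀ j, xs < xB j) ∧
      p = ((Set.Iic xA)ᶜ, (Set.Iic xB)ᶜ)} ∪
  {p | ∃ xA : Fin d → ℝ, (∀ j, xs < xA j) ∧ p = ((Set.Iic xA)ᶜ, Set.univ)}

end Extremogram

end

namespace Extremogram

/-! ### Covering numbers -/

/-! Each set $D$ is described by finitely many thresholds $\theta_c$, one per coordinate of $\mathbb
R^{3d}$, and a Boolean rule $\Phi$ on the pattern of exceeded thresholds. Moreover $D\subseteq
B=\{y_1\ne0\}$, because $x_*>0$ keeps $0$ out of $A$. For a common rule, $|f-g|$ on a block is at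
most the count of points in $B$, and also at most the number of points of $B$ separated by the two
threshold vectors, summed over coordinates. Multiplying the two bounds gives
$d_n(f,g)^2\le\sum_c|S_c(\theta_c)-S_c(\theta'_c)|$ (`sum_sq_sub_le`), where each weighted empirical
survival function $S_c$ is monotone with values between $0$ and the normalized sum $Q_n$ of squared
counts (`squareMass`). Rounding the values $S_c(\theta_c)$ therefore yields a covering number
polynomial in $Q_n/\varepsilon^2$ (`coveringNumber_blockDist_le`). It remains to bound $Q_n$ in
probability. The moment condition and $m_nr_n\le n$ bound $EQ_n$, and Markov's inequality concludes
(`condD6_of_isPatternClass`). -/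

theorem coveringNumber_le_card {α β : Type*} (ρ : α → α → ℝ) (S : Set α) (ε : ℝ)
    (φ : α → β) (B : Finset β) (hB : ∀ f ∈ S, φ f ∈ B)
    (hφ : ∀ f ∈ S, ∀ g ∈ S, φ f = φ g → ρ f g < ε) :
    coveringNumber ρ S ε ≤ (B.card : ℕ∞) := by
  classical
  -- Centres must lie in `S`, so only labels attained on `S` are kept, with one representative each.
  set B' : Finset β := B.filter fun b => ∃ f ∈ S, φ f = b with hB'
  have hex : ∀ b : B', ∃ f ∈ S, φ f = b.1 := fun b => (Finset.mem_filter.1 b.2).2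
  choose g hgS hg using hex
  have hcard : (Finset.univ.image g).card ≤ B.card :=
    Finset.card_image_le.trans (by
      rw [Finset.card_univ, Fintype.card_coe]
      exact Finset.card_filter_le _ _)
  refine le_trans ?_ (Nat.cast_le.2 hcard)
  refine iInf_le_of_le (Finset.univ.image g) (iInf_le_of_le ?_ (iInf_le_of_le ?_ le_rfl))
  · intro f hf
    obtain ⟨b, -, rfl⟩ := Finset.mem_image.1 (Finset.mem_coe.1 hf)
    exact hgS b
  · intro f hf
    have hb : φ f ∈ B' := Finset.mem_filter.2 ⟨hB f hf, f, hf, rfl⟩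
    exact ⟨g ⟨φ f, hb⟩, Finset.mem_image_of_mem _ (Finset.mem_univ _),
      hφ f hf _ (hgS _) (hg ⟨φ f, hb⟩).symm⟩

theorem toENNReal_log_le_of_le_exp {x : ℕ∞} {K : ℕ} (hx : x ≤ (K : ℕ∞)) {y : ℝ}
    (hK : (K : ℝ) ≤ Real.exp y) :
    (ENNReal.log ((x : ℕ∞) : ℝ≥0∞)).toENNReal ≤ ENNReal.ofReal y := by
  have h1 : ((x : ℕ∞) : ℝ≥0∞) ≤ ENNReal.ofReal (Real.exp y) := by
    calc ((x : ℕ∞) : ℝ≥0∞) ≤ ((K : ℕ∞) : ℝ≥0∞) := by exact_mod_cast hx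
      _ = ENNReal.ofReal (K : ℝ) := by simp
      _ ≤ _ := ENNReal.ofReal_le_ofReal hK
  have h2 : ENNReal.log (ENNReal.ofReal (Real.exp y)) = (y : EReal) := by
    rw [ENNReal.log_ofReal_of_pos (Real.exp_pos y), Real.log_exp]
  have h3 := ENNReal.log_monotone h1
  rw [h2] at h3
  simpa using EReal.toENNReal_le_toENNReal h3

/-- An entropy of order `1 / ε` has an entropy integral of order `√η`. -/
theorem entropyIntegral_le {α : Type*} (ρ : α → α → ℝ) (S : Set α) {C η : ℝ} (hC : 0 ≤ C)
    (hη : 0 < η)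
    (h : ∀ ε ∈ Set.Ioc 0 η, (ENNReal.log ((coveringNumber ρ S ε : ℕ∞) : ℝ≥0∞)).toENNReal ≤
      ENNReal.ofReal (C / ε)) :
    entropyIntegral ρ S η ≤ ENNReal.ofReal (2 * √C * √η) := by
  have hint : IntervalIntegrable (fun ε : ℝ => √C * ε ^ (-(1 / 2) : ℝ)) volume 0 η :=
    (intervalIntegral.intervalIntegrable_rpow' (by norm_num)).const_mul _
  have hval : ∫ ε in (0 : ℝ)..η, √C * ε ^ (-(1 / 2) : ℝ) = 2 * √C * √η := by
    rw [intervalIntegral.integral_const_mul, integral_rpow (Or.inl (by norm_num)),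
      Real.sqrt_eq_rpow η]
    norm_num
    ring
  calc entropyIntegral ρ S η
      ≤ ∫⁻ ε in Set.Ioc 0 η, ENNReal.ofReal (√C * ε ^ (-(1 / 2) : ℝ)) := by
        refine setLIntegral_mono' measurableSet_Ioc fun ε hε => ?_
        refine (ENNReal.rpow_le_rpow (h ε hε) (by norm_num)).trans ?_
        rw [ENNReal.ofReal_rpow_of_nonneg (div_nonneg hC hε.1.le) (by norm_num)]
        refine ENNReal.ofReal_le_ofReal (le_of_eq ?_)
        rw [Real.div_rpow hC hε.1.le, Real.rpow_neg hε.1.le, ← Real.sqrt_eq_rpow C]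
        rfl
    _ = ENNReal.ofReal (2 * √C * √η) := by
        rw [← hval, intervalIntegral.integral_of_le hη.le,
          ofReal_integral_eq_lintegral_ofReal]
        · exact (intervalIntegrable_iff_integrableOn_Ioc_of_le hη.le).1 hint
        · refine (ae_restrict_mem measurableSet_Ioc).mono fun ε hε => ?_
          exact mul_nonneg (Real.sqrt_nonneg _) (Real.rpow_nonneg hε.1.le _)

/-! ### Boolean combinations of half-spaces -/

/-- The set of points whose pattern `{c | θ c < coord c y}` belongs to `Φ`. -/
def patternSet {E ι : Type*} (coord : E → ι → ℝ) (Φ : Set (Set ι)) (θ : ι → ℝ) : Set E :=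
  {y | {c | θ c < coord y c} ∈ Φ}

/-- The number of components of the vector `y` that lie in `B`. -/
noncomputable def countIn {E : Type*} (B : Set E) {q : ℕ} (y : Fin q → E) : ℝ :=
  ∑ i, B.indicator (fun _ => (1 : ℝ)) (y i)

theorem countIn_nonneg {E : Type*} (B : Set E) {q : ℕ} (y : Fin q → E) : 0 ≤ countIn B y :=
  Finset.sum_nonneg fun _ _ => Set.indicator_nonneg (fun _ _ => zero_le_one) _

/-- Outside `B` both indicators vanish. Inside, equal patterns give equal membership because the
rule `Φ` is shared; otherwise some coordinate contributes 1 to the sum. -/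
theorem abs_indicator_patternSet_sub_le {E ι : Type*} [Fintype ι] (coord : E → ι → ℝ)
    (Φ : Set (Set ι)) (θ θ' : ι → ℝ) (B : Set E) (h : patternSet coord Φ θ ⊆ B)
    (h' : patternSet coord Φ θ' ⊆ B) (y : E) :
    |(patternSet coord Φ θ).indicator (fun _ => (1 : ℝ)) y -
      (patternSet coord Φ θ').indicator (fun _ => (1 : ℝ)) y| ≤
    B.indicator (fun _ => (1 : ℝ)) y *
      ∑ c, |(Set.Iio (coord y c)).indicator (fun _ => (1 : ℝ)) (θ c) -
        (Set.Iio (coord y c)).indicator (fun _ => (1 : ℝ)) (θ' c)| := by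
  classical
  by_cases hy : y ∈ B
  · rw [Set.indicator_of_mem hy, one_mul]
    by_cases hc : ∀ c, θ c < coord y c ↔ θ' c < coord y c
    · have : {c | θ c < coord y c} = {c | θ' c < coord y c} := Set.ext hc
      have h2 : y ∈ patternSet coord Φ θ ↔ y ∈ patternSet coord Φ θ' := by
        simp only [patternSet, Set.mem_ofPred_eq, this]
      rw [Set.indicator_apply, Set.indicator_apply, if_congr h2 rfl rfl, sub_self, abs_zero]
      exact Finset.sum_nonneg fun _ _ => abs_nonneg _
    · push Not at hc
      obtain ⟨c, hc⟩ := hc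
      have h1 : (1 : ℝ) ≤ |(Set.Iio (coord y c)).indicator (fun _ => (1 : ℝ)) (θ c) -
          (Set.Iio (coord y c)).indicator (fun _ => (1 : ℝ)) (θ' c)| := by
        simp only [Set.indicator_apply, Set.mem_Iio]
        rcases hc with hc | hc
        · rw [if_pos hc.1, if_neg (not_lt.2 hc.2)]; norm_num
        · rw [if_neg (not_lt.2 hc.1), if_pos hc.2]; norm_num
      refine le_trans ?_ (h1.trans (Finset.single_le_sum (f := fun c =>
        |(Set.Iio (coord y c)).indicator (fun _ => (1 : ℝ)) (θ c) -
          (Set.Iio (coord y c)).indicator (fun _ => (1 : ℝ)) (θ' c)|)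
        (fun _ _ => abs_nonneg _) (Finset.mem_univ c)))
      simp only [Set.indicator_apply]
      split_ifs <;> norm_num
  · rw [Set.indicator_of_notMem hy, Set.indicator_of_notMem (fun hm => hy (h hm)),
      Set.indicator_of_notMem (fun hm => hy (h' hm))]
    simp

theorem abs_indicator_sub_le {E : Type*} {D D' B : Set E} (h : D ⊆ B) (h' : D' ⊆ B) (y : E) :
    |D.indicator (fun _ => (1 : ℝ)) y - D'.indicator (fun _ => (1 : ℝ)) y| ≤
      B.indicator (fun _ => (1 : ℝ)) y := by
  classical
  simp only [Set.indicator_apply]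
  have := @h y
  have := @h' y
  split_ifs <;> first | tauto | norm_num

/-- The weighted empirical survival function of the coordinate `c`. -/
noncomputable def survival {E ι : Type*} (coord : E → ι → ℝ) (B : Set E) (s : ℝ) {m q : ℕ}
    (Y : Fin m → Fin q → E) (c : ι) (t : ℝ) : ℝ :=
  s * ∑ j, countIn B (Y j) * ∑ i, B.indicator (fun _ => (1 : ℝ)) (Y j i) *
    (Set.Iio (coord (Y j i) c)).indicator (fun _ => (1 : ℝ)) t

/-- The normalized sum of the squared counts. -/
noncomputable def squareMass {E : Type*} (B : Set E) (s : ℝ) {m q : ℕ}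
    (Y : Fin m → Fin q → E) : ℝ :=
  s * ∑ j, countIn B (Y j) ^ 2

theorem survival_nonneg {E ι : Type*} (coord : E → ι → ℝ) (B : Set E) {s : ℝ} (hs : 0 ≤ s)
    {m q : ℕ} (Y : Fin m → Fin q → E) (c : ι) (t : ℝ) : 0 ≤ survival coord B s Y c t :=
  mul_nonneg hs (Finset.sum_nonneg fun _ _ => mul_nonneg (countIn_nonneg _ _)
    (Finset.sum_nonneg fun _ _ => mul_nonneg (Set.indicator_nonneg (fun _ _ => zero_le_one) _)
      (Set.indicator_nonneg (fun _ _ => zero_le_one) _)))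

theorem survival_le {E ι : Type*} (coord : E → ι → ℝ) (B : Set E) {s : ℝ} (hs : 0 ≤ s)
    {m q : ℕ} (Y : Fin m → Fin q → E) (c : ι) (t : ℝ) :
    survival coord B s Y c t ≤ squareMass B s Y := by
  refine mul_le_mul_of_nonneg_left (Finset.sum_le_sum fun j _ => ?_) hs
  rw [sq]
  refine mul_le_mul_of_nonneg_left (Finset.sum_le_sum fun i _ => ?_) (countIn_nonneg _ _)
  refine mul_le_of_le_one_right (Set.indicator_nonneg (fun _ _ => zero_le_one) _) ?_
  exact Set.indicator_le_self' (fun _ _ => zero_le_one) _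

/-- Half-line indicators are monotone in the threshold, so all differences have the same sign and
the absolute value can be moved outside the sums. -/
theorem abs_survival_sub {E ι : Type*} (coord : E → ι → ℝ) (B : Set E) {s : ℝ} (hs : 0 ≤ s)
    {m q : ℕ} (Y : Fin m → Fin q → E) (c : ι) (t t' : ℝ) :
    s * ∑ j, countIn B (Y j) * ∑ i, B.indicator (fun _ => (1 : ℝ)) (Y j i) *
      |(Set.Iio (coord (Y j i) c)).indicator (fun _ => (1 : ℝ)) t -
        (Set.Iio (coord (Y j i) c)).indicator (fun _ => (1 : ℝ)) t'| =
    |survival coord B s Y c t - survival coord B s Y c t'| := by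
  classical
  wlog h : t ≤ t' generalizing t t'
  · rw [abs_sub_comm (survival coord B s Y c t), ← this t' t (le_of_not_ge h)]
    simp only [abs_sub_comm]
  have key : ∀ x : ℝ, (Set.Iio x).indicator (fun _ => (1 : ℝ)) t' ≤
      (Set.Iio x).indicator (fun _ => (1 : ℝ)) t := by
    intro x
    simp only [Set.indicator_apply, Set.mem_Iio]
    split_ifs <;> linarith
  have hsub : survival coord B s Y c t - survival coord B s Y c t' =
      s * ∑ j, countIn B (Y j) * ∑ i, B.indicator (fun _ => (1 : ℝ)) (Y j i) *
      ((Set.Iio (coord (Y j i) c)).indicator (fun _ => (1 : ℝ)) t -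
        (Set.Iio (coord (Y j i) c)).indicator (fun _ => (1 : ℝ)) t') := by
    simp only [survival, ← mul_sub, ← Finset.sum_sub_distrib]
  rw [hsub, abs_of_nonneg]
  · simp only [abs_of_nonneg (sub_nonneg.2 (key _))]
  · exact mul_nonneg hs (Finset.sum_nonneg fun _ _ => mul_nonneg (countIn_nonneg _ _)
      (Finset.sum_nonneg fun _ _ => mul_nonneg (Set.indicator_nonneg (fun _ _ => zero_le_one) _)
        (sub_nonneg.2 (key _))))

/-- One factor of the square is bounded by the count in `B`, the other by the coordinatewise
differences; the product is the weight built into `survival`. -/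
theorem sum_sq_sub_le {E ι : Type*} [Fintype ι] (coord : E → ι → ℝ) (B : Set E) {s : ℝ}
    (hs : 0 ≤ s) {m q : ℕ} (Y : Fin m → Fin q → E) (Φ : Set (Set ι)) (θ θ' : ι → ℝ)
    (h : patternSet coord Φ θ ⊆ B) (h' : patternSet coord Φ θ' ⊆ B) :
    s * ∑ j, (countFunctional (patternSet coord Φ θ) ⟨q, Y j⟩ -
      countFunctional (patternSet coord Φ θ') ⟨q, Y j⟩) ^ 2 ≤
    ∑ c, |survival coord B s Y c (θ c) - survival coord B s Y c (θ' c)| := by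
  simp only [← abs_survival_sub coord B hs Y]
  rw [← Finset.mul_sum, Finset.sum_comm]
  refine mul_le_mul_of_nonneg_left (Finset.sum_le_sum fun j _ => ?_) hs
  rw [← Finset.mul_sum, Finset.sum_comm, ← sq_abs, sq]
  simp only [countFunctional, ← Finset.sum_sub_distrib, ← Finset.mul_sum]
  refine mul_le_mul ?_ ?_ (abs_nonneg _) (countIn_nonneg _ _)
  · exact (Finset.abs_sum_le_sum_abs _ _).trans
      (Finset.sum_le_sum fun i _ => abs_indicator_sub_le h h' _)
  · exact (Finset.abs_sum_le_sum_abs _ _).trans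
      (Finset.sum_le_sum fun i _ => abs_indicator_patternSet_sub_le coord Φ θ θ' B h h' _)

/-- A class of functionals counting the points in pattern sets contained in `B`. -/
def IsPatternClass {E ι : Type*} (coord : E → ι → ℝ) (B : Set E) (F : Set (Cluster E → ℝ)) :
    Prop :=
  ∀ f ∈ F, ∃ (Φ : Set (Set ι)) (θ : ι → ℝ), patternSet coord Φ θ ⊆ B ∧
    f = countFunctional (patternSet coord Φ θ)

/-! ### Random covering numbers and the entropy condition for pattern classes -/

/-- Functionals are labelled by their rule and by the survival values rounded to multiples of `w`.
Equal labels force a squared distance of at most `w` per coordinate. -/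
theorem coveringNumber_blockDist_le {E ι : Type*} [Fintype ι] (coord : E → ι → ℝ) (B : Set E)
    {F : Set (Cluster E → ℝ)} (hF : IsPatternClass coord B F) (n : ℕ) {v : ℝ} (hv : 0 ≤ v)
    {m q : ℕ} (Y : Fin m → Fin q → E) {ε w : ℝ} (hε : 0 < ε) (hw : 0 < w)
    (hwε : Fintype.card ι * w < ε ^ 2) :
    coveringNumber (blockDist n v Y) F ε ≤ ((Nat.card (Set (Set ι)) *
      (⌊squareMass B (1 / ((n : ℝ) * v)) Y / w⌋₊ + 1) ^ Fintype.card ι : ℕ) : ℕ∞) := by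
  classical
  choose! Φ θ hB hf using hF
  set s : ℝ := 1 / ((n : ℝ) * v) with hs_def
  have hs : 0 ≤ s := by positivity
  refine (coveringNumber_le_card _ F ε
    (fun f => (Φ f, fun c => ⌊survival coord B s Y c (θ f c) / w⌋₊))
    (Finset.univ ×ˢ Fintype.piFinset fun _ : ι =>
      Finset.range (⌊squareMass B s Y / w⌋₊ + 1)) ?_ ?_).trans (le_of_eq ?_)
  · intro f _
    simp only [Finset.mem_product, Finset.mem_univ, true_and, Fintype.mem_piFinset,
      Finset.mem_range, Nat.lt_succ_iff]
    intro c
    gcongr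
    exact survival_le coord B hs Y c _
  · intro f hfF g hgF hfg
    simp only [Prod.mk.injEq] at hfg
    obtain ⟨hΦ, hfl⟩ := hfg
    have hfl' : ∀ c, |survival coord B s Y c (θ f c) - survival coord B s Y c (θ g c)| ≤ w := by
      intro c
      have hc := congrFun hfl c
      have h1 := Nat.floor_le (div_nonneg (survival_nonneg coord B hs Y c (θ f c)) hw.le)
      have h2 := Nat.lt_floor_add_one (survival coord B s Y c (θ f c) / w)
      have h3 := Nat.floor_le (div_nonneg (survival_nonneg coord B hs Y c (θ g c)) hw.le)
      have h4 := Nat.lt_floor_add_one (survival coord B s Y c (θ g c) / w)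
      rw [hc] at h1 h2
      have h5 : |survival coord B s Y c (θ f c) / w - survival coord B s Y c (θ g c) / w| ≤ 1 :=
        abs_le.2 ⟨by linarith, by linarith⟩
      rwa [← sub_div, abs_div, abs_of_pos hw, div_le_one hw] at h5
    have hB' := hB g hgF
    -- Equality of the rules allows `g` to be written with the rule of `f`, as the comparison
    -- requires.
    rw [← hΦ] at hB'
    have key := sum_sq_sub_le coord B hs Y (Φ f) (θ f) (θ g) (hB f hfF) hB'
    rw [← hf f hfF, show countFunctional (patternSet coord (Φ f) (θ g)) = g by
      rw [hΦ]; exact (hf g hgF).symm] at key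
    unfold blockDist
    rw [Real.sqrt_lt' hε]
    refine (key.trans ?_).trans_lt hwε
    refine (Finset.sum_le_card_nsmul _ _ w fun c _ => hfl' c).trans ?_
    simp
  · simp [Finset.card_product, Nat.card_eq_fintype_card]

/-- The constant in the entropy bound of a pattern class with total squared mass `M`. -/
noncomputable def entropyConst (ι : Type*) [Fintype ι] (M : ℝ) : ℝ :=
  Nat.card (Set (Set ι)) + Fintype.card ι * (2 * √((Fintype.card ι + 1) * M))

/-- The true entropy is logarithmic in `1 / ε`; the cruder order `1 / ε` suffices, since its square
root is integrable at 0. -/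
theorem entropy_blockDist_le {E ι : Type*} [Fintype ι] (coord : E → ι → ℝ) (B : Set E)
    {F : Set (Cluster E → ℝ)} (hF : IsPatternClass coord B F) (n : ℕ) {v : ℝ} (hv : 0 ≤ v)
    {m q : ℕ} (Y : Fin m → Fin q → E) {M : ℝ} (hM : 0 ≤ M)
    (hY : squareMass B (1 / ((n : ℝ) * v)) Y ≤ M) {ε : ℝ} (hε : 0 < ε) (hε1 : ε ≤ 1) :
    (ENNReal.log ((coveringNumber (blockDist n v Y) F ε : ℕ∞) : ℝ≥0∞)).toENNReal ≤
      ENNReal.ofReal (entropyConst ι M / ε) := by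
  set p := Fintype.card ι with hp
  -- The `+ 1` makes `p * w < ε ^ 2` strict and covers `p = 0`.
  have hw : 0 < ε ^ 2 / ((p : ℝ) + 1) := by positivity
  have hwε : (p : ℝ) * (ε ^ 2 / ((p : ℝ) + 1)) < ε ^ 2 := by
    rw [mul_div_assoc', div_lt_iff₀ (by positivity)]
    nlinarith [sq_pos_of_pos hε]
  refine toENNReal_log_le_of_le_exp
    (coveringNumber_blockDist_le coord B hF n hv Y hε hw hwε) ?_
  set K : ℕ := Nat.card (Set (Set ι))
  set a : ℝ := ((p : ℝ) + 1) * M with ha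
  have ha0 : 0 ≤ a := by positivity
  have h1 : ((⌊squareMass B (1 / ((n : ℝ) * v)) Y / (ε ^ 2 / ((p : ℝ) + 1))⌋₊ : ℕ) : ℝ) ≤
      a / ε ^ 2 := by
    have : M / (ε ^ 2 / ((p : ℝ) + 1)) = a / ε ^ 2 := by rw [ha]; field_simp
    rw [← this]
    refine (Nat.cast_le.2 (Nat.floor_mono (div_le_div_of_nonneg_right hY hw.le))).trans ?_
    exact Nat.floor_le (div_nonneg hM hw.le)
  -- With `x = √a / ε`: `x² + 1 ≤ (x + 1)² ≤ exp (2x)`.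
  have h2 : a / ε ^ 2 + 1 ≤ Real.exp (2 * √a / ε) := by
    have h3 : √a / ε + 1 ≤ Real.exp (√a / ε) := Real.add_one_le_exp _
    have h4 : 0 ≤ √a / ε := by positivity
    calc a / ε ^ 2 + 1 = (√a / ε) ^ 2 + 1 := by rw [div_pow, Real.sq_sqrt ha0]
      _ ≤ (√a / ε + 1) ^ 2 := by nlinarith
      _ ≤ Real.exp (√a / ε) ^ 2 := by gcongr
      _ = Real.exp (2 * √a / ε) := by rw [← Real.exp_nat_mul]; congr 1; push_cast; ring
  have h5 : (K : ℝ) ≤ Real.exp (K / ε) := by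
    have : (K : ℝ) ≤ K / ε := le_div_self (Nat.cast_nonneg _) hε hε1
    linarith [Real.add_one_le_exp ((K : ℝ) / ε)]
  push_cast
  calc (K : ℝ) * ((⌊squareMass B (1 / ((n : ℝ) * v)) Y / (ε ^ 2 / ((p : ℝ) + 1))⌋₊ : ℝ) + 1) ^ p
      ≤ Real.exp (K / ε) * Real.exp (2 * √a / ε) ^ p := by
        gcongr
        exact (add_le_add_left h1 1).trans h2
    _ = Real.exp (entropyConst ι M / ε) := by
        rw [← Real.exp_nat_mul, ← Real.exp_add]
        congr 1
        simp only [entropyConst]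
        ring

theorem entropyConst_nonneg (ι : Type*) [Fintype ι] (M : ℝ) : 0 ≤ entropyConst ι M := by
  unfold entropyConst
  positivity

/-- Condition (D6) holds for pattern classes whose normalized squared counts are bounded in
mean. -/
theorem condD6_of_isPatternClass {Ω' E ι : Type*} [MeasurableSpace Ω'] [Fintype ι]
    (P' : Measure Ω') [IsProbabilityMeasure P'] (coord : E → ι → ℝ) (B : Set E)
    {F : Set (Cluster E → ℝ)} (hF : IsPatternClass coord B F) (v : ℕ → ℝ) (hv : ∀ n, 0 ≤ v n)
    (r : ℕ → ℕ) (Ystar : ∀ n : ℕ, Fin (n / r n) → Ω' → (Fin (r n) → E)) (C : ℝ)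
    (hint : ∀ n : ℕ, Integrable
      (fun ω => squareMass B (1 / ((n : ℝ) * v n)) fun j => Ystar n j ω) P')
    (hC : ∀ᶠ n : ℕ in atTop,
      ∫ ω, squareMass B (1 / ((n : ℝ) * v n)) (fun j => Ystar n j ω) ∂P' ≤ C) :
    CondD6 P' F v r Ystar := by
  intro τ hτ
  rw [ENNReal.tendsto_nhds_zero]
  intro e he
  obtain ⟨e', he'0, he'⟩ : ∃ e' : ℝ, 0 < e' ∧ ENNReal.ofReal e' ≤ e := by
    obtain ⟨x, hx0, hx⟩ := ENNReal.lt_iff_exists_nnreal_btwn.1 he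
    exact ⟨x, by simpa using hx0, by simpa using hx.le⟩
  -- Chosen so that Markov's inequality gives probability at most `C / M ≤ e'`; the maximum with 1
  -- keeps `M` positive.
  set M : ℝ := max C 1 / e' with hMdef
  have hM : 0 < M := by positivity
  have hlim : Tendsto (fun η : ℝ => 2 * √(entropyConst ι M) * √η) (𝓝[>] 0) (𝓝 0) := by
    have : Continuous fun η : ℝ => 2 * √(entropyConst ι M) * √η := by fun_prop
    simpa using (this.tendsto 0).mono_left nhdsWithin_le_nhds
  -- For such `η`, an entropy integral above `τ` forces the squared mass to be at least `M`.
  filter_upwards [hlim.eventually (gt_mem_nhds hτ), Ioc_mem_nhdsGT (zero_lt_one' ℝ)] with η hητ hη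
  refine (limsup_le_of_le (by isBoundedDefault) ?_).trans he'
  filter_upwards [hC] with n hn
  have hsub : {ω | ENNReal.ofReal τ <
      entropyIntegral (blockDist n (v n) (fun j => Ystar n j ω)) F η} ⊆
      {ω | M ≤ squareMass B (1 / ((n : ℝ) * v n)) fun j => Ystar n j ω} := by
    intro ω hω
    by_contra hlt
    refine (lt_irrefl _) ((lt_of_lt_of_le hω (entropyIntegral_le _ F
      (entropyConst_nonneg ι M) hη.1 fun ε hε => entropy_blockDist_le coord B hF n (hv n) _ hM.le
        (le_of_not_ge hlt) hε.1 (hε.2.trans hη.2))).trans_le ?_)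
    exact ENNReal.ofReal_le_ofReal hητ.le
  refine (measure_mono hsub).trans ?_
  have hnn : 0 ≤ fun ω => squareMass B (1 / ((n : ℝ) * v n)) fun j => Ystar n j ω := fun ω =>
    mul_nonneg (one_div_nonneg.2 (mul_nonneg (Nat.cast_nonneg _) (hv n)))
      (Finset.sum_nonneg fun _ _ => sq_nonneg _)
  have hmk := mul_meas_ge_le_integral_of_nonneg (ae_of_all _ hnn) (hint n) M
  rw [← ENNReal.ofReal_toReal (measure_ne_top P' _)]
  refine ENNReal.ofReal_le_ofReal ?_
  have h1 : M * P'.real {ω | M ≤ squareMass B (1 / ((n : ℝ) * v n)) fun j => Ystar n j ω} ≤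
      M * e' := by
    refine hmk.trans (hn.trans ?_)
    rw [hMdef, div_mul_cancel₀ _ he'0.ne']
    exact le_max_left _ _
  exact le_of_mul_le_mul_left h1 hM

/-! ### The families of orthants -/

/-- All coordinates of a triple of vectors. -/
def tripleCoord {d : ℕ} (y : (Fin d → ℝ) × (Fin d → ℝ) × (Fin d → ℝ)) :
    Fin d ⊕ Fin d ⊕ Fin d → ℝ :=
  Sum.elim y.1 (Sum.elim y.2.1 y.2.2)

/-- The triples whose first component does not vanish. -/
def fstNeZero (d : ℕ) : Set ((Fin d → ℝ) × (Fin d → ℝ) × (Fin d → ℝ)) := {y | y.1 ≠ 0}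

/-- Excluding 0 from the first factor places the product inside `fstNeZero d`. The factor `ℝ^d` gets
the dummy threshold 0, which the combined rule ignores. -/
theorem isPatternClass_functionalFamily {d : ℕ}
    {C : Set (Set (Fin d → ℝ) × Set (Fin d → ℝ))}
    (hC : ∀ p ∈ C, 0 ∉ p.1 ∧ ∃ (Ψ Ψ' : Set (Set (Fin d))) (x x' : Fin d → ℝ),
      p.1 = {y | {j | x j < y j} ∈ Ψ} ∧ p.2 = {y | {j | x' j < y j} ∈ Ψ'}) :
    IsPatternClass tripleCoord (fstNeZero d) (functionalFamily C) := by
  rintro f ⟨⟨A, A'⟩, hp, hf⟩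
  obtain ⟨h0, Ψ, Ψ', x, x', rfl, rfl⟩ := hC _ hp
  have hsub : ∀ T : Set ((Fin d → ℝ) × (Fin d → ℝ)),
      {y : Fin d → ℝ | {j | x j < y j} ∈ Ψ} ×ˢ T ⊆ fstNeZero d := by
    rintro T ⟨y, z⟩ hy (rfl : y = 0)
    exact h0 hy.1
  rcases hf with rfl | rfl
  · have heq : ({y : Fin d → ℝ | {j | x j < y j} ∈ Ψ} ×ˢ {y : Fin d → ℝ | {j | x' j < y j} ∈ Ψ'} ×ˢ
        (Set.univ : Set (Fin d → ℝ))) = patternSet tripleCoord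
          {s | Sum.inl ⁻¹' s ∈ Ψ ∧ (Sum.inr ∘ Sum.inl) ⁻¹' s ∈ Ψ'}
          (Sum.elim x (Sum.elim x' 0)) := by
      ext y
      simp [patternSet, tripleCoord, Set.preimage]
    exact ⟨_, _, heq ▸ hsub _, congrArg countFunctional heq⟩
  · have heq : ({y : Fin d → ℝ | {j | x j < y j} ∈ Ψ} ×ˢ (Set.univ : Set (Fin d → ℝ)) ×ˢ
        {y : Fin d → ℝ | {j | x' j < y j} ∈ Ψ'}) = patternSet tripleCoord
          {s | Sum.inl ⁻¹' s ∈ Ψ ∧ (Sum.inr ∘ Sum.inr) ⁻¹' s ∈ Ψ'}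
          (Sum.elim x (Sum.elim 0 x')) := by
      ext y
      simp [patternSet, tripleCoord, Set.preimage]
    exact ⟨_, _, heq ▸ hsub _, congrArg countFunctional heq⟩

theorem upperOrthant_eq_pattern {d : ℕ} (x : Fin d → ℝ) :
    upperOrthant x = {y | {j | x j < y j} ∈ ({Set.univ} : Set (Set (Fin d)))} := by
  ext y
  simp [upperOrthant, Set.eq_univ_iff_forall]

theorem compl_Iic_eq_pattern {d : ℕ} (x : Fin d → ℝ) :
    (Set.Iic x)ᶜ = {y | {j | x j < y j} ∈ {s : Set (Fin d) | s.Nonempty}} := by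
  ext y
  simp [Pi.le_def, Set.Nonempty]

/-- Some coordinate of `xA` exceeds `xs > 0`, so the orthant misses the origin. -/
theorem isPatternClass_upperFamily (d : ℕ) {xs : ℝ} (hxs : 0 < xs) :
    IsPatternClass tripleCoord (fstNeZero d) (functionalFamily (upperFamily d xs)) := by
  have h0 : ∀ x : Fin d → ℝ, (¬ ∀ j, x j ≤ xs) → (0 : Fin d → ℝ) ∉ upperOrthant x :=
    fun x hx hm => hx fun j => (hm j).le.trans hxs.le
  refine isPatternClass_functionalFamily ?_
  rintro _ (⟨xA, xB, hA, -, rfl⟩ | ⟨xA, hA, rfl⟩)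
  · exact ⟨h0 _ hA, _, _, xA, xB, upperOrthant_eq_pattern _, upperOrthant_eq_pattern _⟩
  · exact ⟨h0 _ hA, _, Set.univ, xA, 0, upperOrthant_eq_pattern _, by simp⟩

theorem isPatternClass_lowerComplFamily (d : ℕ) {xs : ℝ} (hxs : 0 < xs) :
    IsPatternClass tripleCoord (fstNeZero d) (functionalFamily (lowerComplFamily d xs)) := by
  have h0 : ∀ x : Fin d → ℝ, (∀ j, xs < x j) → (0 : Fin d → ℝ) ∉ (Set.Iic x)ᶜ :=
    fun x hx hm => hm fun j => (hxs.trans (hx j)).le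
  refine isPatternClass_functionalFamily ?_
  rintro _ (⟨xA, xB, hA, -, rfl⟩ | ⟨xA, hA, rfl⟩)
  · exact ⟨h0 _ hA, _, _, xA, xB, compl_Iic_eq_pattern _, compl_Iic_eq_pattern _⟩
  · exact ⟨h0 _ hA, _, Set.univ, xA, 0, compl_Iic_eq_pattern _, by simp⟩

/-! ### Moments of the number of exceedances -/

theorem measurableSet_lowerBox (d : ℕ) (c : ℝ) : MeasurableSet (lowerBox d c) := by
  have : lowerBox d c = ⋂ j, {x | x j < c} := by ext; simp [lowerBox]
  rw [this]
  exact MeasurableSet.iInter fun j => measurableSet_lt (measurable_pi_apply j) measurable_const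

theorem measurableSet_fstNeZero (d : ℕ) : MeasurableSet (fstNeZero d) :=
  (measurable_fst (measurableSet_singleton 0)).compl

/-- Since `xs > 0`, the origin lies in the lower box, so a value kept by the truncation cannot be 0.
-/
theorem tildeX_ne_zero_iff {Ω : Type*} {d : ℕ} (X : ℕ → Ω → (Fin d → ℝ)) (b : ℕ → ℝ) {xs : ℝ}
    (hxs : 0 < xs) {n : ℕ} (hb : 0 < b n) (i : ℕ) (ω : Ω) :
    tildeX X b xs n i ω ≠ 0 ↔ X i ω ∉ lowerBox d (b n * xs) := by
  have hiff : (b n)⁻¹ • X i ω ∈ lowerBox d xs ↔ X i ω ∈ lowerBox d (b n * xs) := by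
    refine forall_congr' fun j => ?_
    rw [Pi.smul_apply, smul_eq_mul, inv_mul_lt_iff₀ hb]
  unfold tildeX
  split_ifs with h
  · simpa using hiff.1 h
  · refine iff_of_true (fun h0 => h ?_) fun hm => h (hiff.2 hm)
    rw [h0]
    exact fun _ => hxs

theorem measurable_countIn {E : Type*} [MeasurableSpace E] {B : Set E} (hB : MeasurableSet B)
    (q : ℕ) : Measurable fun y : Fin q → E => countIn B y :=
  Finset.measurable_sum _ fun i _ =>
    (measurable_const.indicator hB).comp (measurable_pi_apply i)

theorem countIn_le {E : Type*} (B : Set E) {q : ℕ} (y : Fin q → E) : countIn B y ≤ q := by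
  refine (Finset.sum_le_card_nsmul _ _ 1 fun i _ => ?_).trans (by simp)
  exact Set.indicator_le_self' (fun _ _ => zero_le_one) _

/-- A count is either 0 or at least 1, so higher powers dominate the square; this is how the `2 + δ`
moment controls the second moment. -/
theorem sq_le_rpow_of_eq_natCast {x : ℝ} {N : ℕ} (hx : x = N) {p : ℝ} (hp : 2 ≤ p) :
    x ^ 2 ≤ x ^ p := by
  subst hx
  rcases Nat.eq_zero_or_pos N with rfl | hN
  · simp [Real.zero_rpow (by linarith : p ≠ 0)]
  · rw [← Real.rpow_two]
    exact Real.rpow_le_rpow_of_exponent_le (by exact_mod_cast hN) hp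

theorem integrable_countIn_sq {Ω E : Type*} [MeasurableSpace Ω] [MeasurableSpace E]
    (P : Measure Ω) [IsFiniteMeasure P] {B : Set E} (hB : MeasurableSet B) {q : ℕ}
    {Y : Ω → Fin q → E} (hY : AEMeasurable Y P) :
    Integrable (fun ω => countIn B (Y ω) ^ 2) P := by
  refine Integrable.of_bound
    (((measurable_countIn hB q).pow_const 2).comp_aemeasurable hY).aestronglyMeasurable
    ((q : ℝ) ^ 2) (ae_of_all _ fun ω => ?_)
  rw [Real.norm_of_nonneg (sq_nonneg _)]
  exact pow_le_pow_left₀ (countIn_nonneg _ _) (countIn_le _ _) 2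

theorem measurable_tildeX {Ω : Type*} [MeasurableSpace Ω] {d : ℕ} {X : ℕ → Ω → (Fin d → ℝ)}
    (hX : ∀ t, Measurable (X t)) (b : ℕ → ℝ) (xs : ℝ) (n i : ℕ) :
    Measurable (tildeX X b xs n i) := by
  unfold tildeX
  have hm : Measurable fun ω => (b n)⁻¹ • X i ω := (hX i).const_smul ((b n)⁻¹)
  exact Measurable.ite (hm (measurableSet_lowerBox d xs)) measurable_const hm

theorem measurable_firstBlock_lagX {Ω : Type*} [MeasurableSpace Ω] {d : ℕ}
    {X : ℕ → Ω → (Fin d → ℝ)} (hX : ∀ t, Measurable (X t)) (b : ℕ → ℝ) (xs : ℝ) (h h' : ℕ)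
    (r : ℕ → ℕ) (n : ℕ) : Measurable (firstBlock (lagX X b xs h h') r n) :=
  measurable_pi_lambda _ fun _ => (measurable_tildeX hX b xs _ _).prodMk
    ((measurable_tildeX hX b xs _ _).prodMk (measurable_tildeX hX b xs _ _))

open Classical in
theorem countIn_firstBlock_lagX {Ω : Type*} {d : ℕ} (X : ℕ → Ω → (Fin d → ℝ)) (b : ℕ → ℝ)
    {xs : ℝ} (hxs : 0 < xs) (h h' : ℕ) (r : ℕ → ℕ) {n : ℕ} (hb : 0 < b n) (ω : Ω) :
    countIn (fstNeZero d) (firstBlock (lagX X b xs h h') r n ω) =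
      ∑ i ∈ Finset.Icc 1 (r n), if X i ω ∈ lowerBox d (b n * xs) then (0 : ℝ) else 1 := by
  -- Blocks are indexed from 0 and the time series sum from 1, hence the shift.
  have h1 : Finset.Icc 1 (r n) = Finset.Ico (0 + 1) (r n + 1) := by
    ext; simp
  rw [h1, ← Finset.sum_Ico_add' (fun i => if X i ω ∈ lowerBox d (b n * xs) then (0 : ℝ) else 1),
    ← Finset.range_eq_Ico, Finset.sum_range]
  refine Finset.sum_congr rfl fun i _ => ?_
  have := tildeX_ne_zero_iff X b hxs hb (i + 1) ω
  rw [Set.indicator_apply]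
  simp only [firstBlock, lagX, fstNeZero, Set.mem_ofPred_eq, this, ite_not]

/-- Only the unlagged first component is counted, so the bound does not depend on the lags. -/
theorem integral_countIn_sq_le_exceedMoment {Ω : Type*} [MeasurableSpace Ω] (P : Measure Ω)
    [IsProbabilityMeasure P] {d : ℕ} {X : ℕ → Ω → (Fin d → ℝ)} (hX : ∀ t, Measurable (X t))
    (b : ℕ → ℝ) {xs : ℝ} (hxs : 0 < xs) (h h' : ℕ) (r : ℕ → ℕ) {n : ℕ} (hb : 0 < b n) {p : ℝ}
    (hp : 2 ≤ p) :
    ∫ ω, countIn (fstNeZero d) (firstBlock (lagX X b xs h h') r n ω) ^ 2 ∂P ≤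
      exceedMoment P X b xs r p n := by
  classical
  have hmeas := measurable_firstBlock_lagX hX b xs h h' r n
  have hcount := (measurable_countIn (measurableSet_fstNeZero d) (r n)).comp hmeas
  have hmom : exceedMoment P X b xs r p n =
      ∫ ω, countIn (fstNeZero d) (firstBlock (lagX X b xs h h') r n ω) ^ p ∂P := by
    refine integral_congr_ae (ae_of_all _ fun ω => ?_)
    simp only [countIn_firstBlock_lagX X b hxs h h' r hb ω]
  rw [hmom]
  refine integral_mono (integrable_countIn_sq P (measurableSet_fstNeZero d) hmeas.aemeasurable)
    ?_ fun ω => ?_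
  · refine Integrable.of_bound (hcount.pow_const p).aestronglyMeasurable ((r n : ℝ) ^ p)
      (ae_of_all _ fun ω => ?_)
    rw [Real.norm_of_nonneg (Real.rpow_nonneg (countIn_nonneg _ _) _)]
    exact Real.rpow_le_rpow (countIn_nonneg _ _) (countIn_le _ _) (by linarith)
  · refine sq_le_rpow_of_eq_natCast (N := (Finset.univ.filter fun i =>
      firstBlock (lagX X b xs h h') r n ω i ∈ fstNeZero d).card) ?_ hp
    simp [countIn, Set.indicator_apply]

theorem exceedProb_le_nonzeroProb_lagX {Ω : Type*} [MeasurableSpace Ω] (P : Measure Ω)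
    [IsProbabilityMeasure P] {d : ℕ} {X : ℕ → Ω → (Fin d → ℝ)} (hstat : IsStationary P X)
    (b : ℕ → ℝ) {xs : ℝ} (hxs : 0 < xs) (h h' : ℕ) {n : ℕ} (hb : 0 < b n) :
    exceedProb P X b xs n ≤ nonzeroProb P (lagX X b xs h h') n := by
  -- Stationarity moves the exceedance from time 0 to time 1, where it makes the first component of
  -- the triple nonzero.
  have hid : IdentDistrib (X (0 + 1)) (X 0) P P :=
    (hstat 1).comp (u := fun x : ℕ → Fin d → ℝ => x 0) (measurable_pi_apply 0)
  have heq : exceedProb P X b xs n = P.real {ω | X 1 ω ∉ lowerBox d (b n * xs)} :=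
    congrArg ENNReal.toReal
      (hid.measure_mem_eq (measurableSet_lowerBox d (b n * xs)).compl).symm
  rw [heq]
  refine measureReal_mono fun ω hω h0 => ?_
  exact (tildeX_ne_zero_iff X b hxs hb 1 ω).2 hω (congrArg Prod.fst h0)

theorem integral_squareMass_eq {Ω Ω' E : Type*} [MeasurableSpace Ω] [MeasurableSpace Ω']
    [MeasurableSpace E] (P : Measure Ω) (P' : Measure Ω') [IsFiniteMeasure P'] {B : Set E}
    (hB : MeasurableSet B) {q m : ℕ} {Y : Fin m → Ω' → (Fin q → E)} {Z : Ω → (Fin q → E)}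
    (hY : ∀ j, IdentDistrib (Y j) Z P' P) (s : ℝ) :
    ∫ ω, squareMass B s (fun j => Y j ω) ∂P' = s * (m * ∫ ω, countIn B (Z ω) ^ 2 ∂P) := by
  unfold squareMass
  rw [integral_const_mul, integral_finsetSum _ fun j _ =>
    integrable_countIn_sq P' hB (hY j).aemeasurable_fst]
  have : ∀ j, ∫ ω, countIn B (Y j ω) ^ 2 ∂P' = ∫ ω, countIn B (Z ω) ^ 2 ∂P := fun j =>
    ((hY j).comp ((measurable_countIn hB q).pow_const 2)).integral_eq
  simp [this]

end Extremogram

/-- `a (k n)` are the normalizing constants, `xs` is the threshold `x_*`, `h` and `h'` are the two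
lags, and `Ystar` are i.i.d. copies of the first block of the array `X_{n,i}^{(h, h')}`. -/
theorem mainTheorem12 {Ω Ω' : Type*} [MeasurableSpace Ω] [MeasurableSpace Ω']
    (P : Measure Ω) [IsProbabilityMeasure P] (P' : Measure Ω') [IsProbabilityMeasure P']
    (d : ℕ) (X : ℕ → Ω → (Fin d → ℝ)) (hX : ∀ t, Measurable (X t))
    (hstat : Extremogram.IsStationary P X)
    (a : ℕ → ℝ) (k : ℕ → ℕ) (ha : ∀ᶠ n in atTop, 0 < a (k n))
    (xs : ℝ) (hxs : 0 < xs) (l r : ℕ → ℕ)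
    (hB1 : Extremogram.CondB1 P (Extremogram.tildeX X (fun n => a (k n)) xs) l r)
    (δ : ℝ) (hδ : 0 < δ)
    (hmoment : (fun n => Extremogram.exceedMoment P X (fun n => a (k n)) xs r (2 + δ) n)
      =O[atTop] (fun n => (r n : ℝ) * Extremogram.exceedProb P X (fun n => a (k n)) xs n))
    (h h' : ℕ)
    (Ystar : ∀ n : ℕ, Fin (n / r n) → Ω' →
      (Fin (r n) → (Fin d → ℝ) × (Fin d → ℝ) × (Fin d → ℝ)))
    (hYstar : Extremogram.IsIIDCopies P P'
      (Extremogram.lagX X (fun n => a (k n)) xs h h') r Ystar) :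
    Extremogram.CondD6 P' (Extremogram.functionalFamily (Extremogram.upperFamily d xs))
      (Extremogram.nonzeroProb P (Extremogram.lagX X (fun n => a (k n)) xs h h')) r Ystar ∧
    Extremogram.CondD6 P' (Extremogram.functionalFamily (Extremogram.lowerComplFamily d xs))
      (Extremogram.nonzeroProb P (Extremogram.lagX X (fun n => a (k n)) xs h h')) r Ystar := by

  set b : ℕ → ℝ := fun n => a (k n) with hb
  obtain ⟨C, hCpos, hC⟩ := hmoment.exists_pos
  rw [isBigOWith_iff] at hC
  have hB := Extremogram.measurableSet_fstNeZero d
  have hv : ∀ n, 0 ≤ Extremogram.nonzeroProb P (Extremogram.lagX X b xs h h') n :=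
    fun n => measureReal_nonneg
  have hint : ∀ n : ℕ, Integrable (fun ω => Extremogram.squareMass (Extremogram.fstNeZero d)
      (1 / ((n : ℝ) * Extremogram.nonzeroProb P (Extremogram.lagX X b xs h h') n))
      fun j => Ystar n j ω) P' := fun n =>
    (integrable_finsetSum _ fun j _ => Extremogram.integrable_countIn_sq P' hB
      (hYstar.identDistrib n j).aemeasurable_fst).const_mul _
  have hbound : ∀ᶠ n : ℕ in atTop, ∫ ω, Extremogram.squareMass (Extremogram.fstNeZero d)
      (1 / ((n : ℝ) * Extremogram.nonzeroProb P (Extremogram.lagX X b xs h h') n))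
      (fun j => Ystar n j ω) ∂P' ≤ C := by
    filter_upwards [hC, ha] with n hn hbn
    rw [Extremogram.integral_squareMass_eq P P' hB (hYstar.identDistrib n)]
    have h1 := Extremogram.integral_countIn_sq_le_exceedMoment P hX b hxs h h' r hbn
      (p := 2 + δ) (by linarith)
    have h2 := Extremogram.exceedProb_le_nonzeroProb_lagX P hstat b hxs h h' hbn
    have h3 : 0 ≤ Extremogram.exceedProb P X b xs n := measureReal_nonneg
    have h4 : ((n / r n : ℕ) : ℝ) * (r n : ℝ) ≤ n := by
      exact_mod_cast Nat.div_mul_le_self n (r n)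
    rw [Real.norm_of_nonneg (mul_nonneg (Nat.cast_nonneg _) h3)] at hn
    have h5 := h1.trans ((Real.le_norm_self _).trans hn)
    rw [one_div_mul_eq_div]
    -- This form also covers a vanishing denominator, where the quotient is 0 by convention.
    refine div_le_of_le_mul₀ (mul_nonneg (Nat.cast_nonneg _) (hv n)) hCpos.le ?_
    calc ((n / r n : ℕ) : ℝ) * ∫ ω, Extremogram.countIn (Extremogram.fstNeZero d)
          (Extremogram.firstBlock (Extremogram.lagX X b xs h h') r n ω) ^ 2 ∂P
        ≤ ((n / r n : ℕ) : ℝ) * (C * ((r n : ℝ) * Extremogram.exceedProb P X b xs n)) := by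
          gcongr
      _ = C * ((((n / r n : ℕ) : ℝ) * (r n : ℝ)) * Extremogram.exceedProb P X b xs n) := by ring
      _ ≤ C * (n * Extremogram.nonzeroProb P (Extremogram.lagX X b xs h h') n) := by gcongr
  exact ⟨Extremogram.condD6_of_isPatternClass P' Extremogram.tripleCoord _
      (Extremogram.isPatternClass_upperFamily d hxs) _ hv r Ystar C hint hbound,
    Extremogram.condD6_of_isPatternClass P' Extremogram.tripleCoord _
      (Extremogram.isPatternClass_lowerComplFamily d hxs) _ hv r Ystar C hint hbound⟩
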